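/- For a field $K$ of characteristic $\neq 2$ let $V_0(x)=1$ and $V_i(x)=2T_i(x/2)$ for $i\ge 1$, where $T_i$ is the Chebyshev polynomial of the first kind. A straight-line program over $K$ performs additions, subtractions and multiplications on its inputs, on constants of $K$ and on earlier results; its cost is the total number of these operations (multiplications by constants included). There is an absolute constant $A$ such that the following holds. (i) For every integer $m\ge 1$ there are straight-line programs over $\mathbb{R}$ of cost at most $A\,m\log m$ which, for polynomials $p$ of degree at most $m-1$, convert in either direction between the coefficient vector of $p$ in the power basis $\{1,x,\dots,x^{m-1}\}$ and the coefficient vector of $p$ in the modified Chebyshev basis $\{V_0,V_1,\dots,V_{m-1}\}$ (one program for each direction, working for all $p$). (ii) The same holds over $\mathbb{F}_q$, with the same $A$, for every $m=2^a3^b$ with $a,b\ge 0$ and every prime $q\equiv 1 \pmod{4m}$. -/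

import Mathlib

/-- The arithmetic operations that a program may perform. There is no division: dividing by a fixed
scalar is multiplying by its inverse, so a bound in this model is also one when division is
allowed. -/
inductive ArithOp : Type
  | add
  | sub
  | mul

/-- The effect of an arithmetic operation. -/
def ArithOp.eval {K : Type*} [CommRing K] : ArithOp → K → K → K
  | .add, x, y => x + y
  | .sub, x, y => x - y
  | .mul, x, y => x * y

/-- An operand, when `k` values are available: a constant of `K` or one of these values. -/
inductive Operand (K : Type*) (k : ℕ) : Type _
  | const (c : K)
  | val (i : Fin k)

/-- The value of an operand, given the available values `v`. -/
def Operand.eval {K : Type*} {k : ℕ} (v : Fin k → K) : Operand K k → K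
  | .const c => c
  | .val i => v i

/-- Straight-line programs over `K` with `n` outputs, starting from `k` available values.
A program either stops and names its outputs, or performs one arithmetic operation on two operands,
after which the result is available as one more value. -/
inductive SLP (K : Type*) (n : ℕ) : ℕ → Type _
  | output {k : ℕ} (out : Fin n → Operand K k) : SLP K n k
  | step {k : ℕ} (op : ArithOp) (a b : Operand K k) (rest : SLP K n (k + 1)) : SLP K n k

namespace SLP

/-- The outputs of a program on the input `v`. -/
def run {K : Type*} [CommRing K] {n : ℕ} : {k : ℕ} → SLP K n k → (Fin k → K) → Fin n → K
  | _, .output out, v => fun i => (out i).eval v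
  | _, .step op a b rest, v =>
      rest.run (Fin.snoc (α := fun _ => K) v (op.eval (a.eval v) (b.eval v)))

/-- The number of arithmetic operations that a program performs. Every operation counts,
multiplications by constants included. -/
def cost {K : Type*} {n : ℕ} : {k : ℕ} → SLP K n k → ℕ
  | _, .output _ => 0
  | _, .step _ _ _ rest => rest.cost + 1

end SLP

open Polynomial in
/-- The modified Chebyshev polynomials: `V₀ = 1` and `Vᵢ(x) = 2 Tᵢ(x / 2)` for `i ≥ 1`. -/
noncomputable def modChebyshev (K : Type*) [Field K] : ℕ → K[X]
  | 0 => 1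
  | i + 1 => 2 * (Chebyshev.T K ((i + 1 : ℕ) : ℤ)).comp (C (2 : K)⁻¹ * X)

open Polynomial in
/-- The polynomial `∑_{i < m} pᵢ xⁱ` with coefficient vector `p` in the power basis. -/
noncomputable def ofPowerCoeffs {K : Type*} [Field K] {m : ℕ} (p : Fin m → K) : K[X] :=
  ∑ i : Fin m, C (p i) * X ^ (i : ℕ)

open Polynomial in
/-- The polynomial `∑_{i < m} cᵢ Vᵢ(x)` with coefficient vector `c` in the modified Chebyshev
basis. -/
noncomputable def ofChebyshevCoeffs {K : Type*} [Field K] {m : ℕ} (c : Fin m → K) : K[X] :=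
  ∑ i : Fin m, C (c i) * modChebyshev K (i : ℕ)

/-- On the power-basis coefficients of any polynomial of degree at most `m - 1`, the program returns
the coefficients of the same polynomial in the modified Chebyshev basis. -/
def ComputesPowerToChebyshev {K : Type*} [Field K] {m : ℕ} (P : SLP K m m) : Prop :=
  ∀ p : Fin m → K, ofChebyshevCoeffs (P.run p) = ofPowerCoeffs p

/-- On the coefficients in the modified Chebyshev basis of any polynomial of degree at most `m - 1`,
the program returns the power-basis coefficients of the same polynomial. -/
def ComputesChebyshevToPower {K : Type*} [Field K] {m : ℕ} (P : SLP K m m) : Prop :=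
  ∀ c : Fin m → K, ofPowerCoeffs (P.run c) = ofChebyshevCoeffs c

/-- Over `K`, for polynomials of degree at most `m - 1`, the change of basis can be done with at
most `B` arithmetic operations in either direction. -/
def BaseChangeWithin (K : Type*) [Field K] (m : ℕ) (B : ℝ) : Prop :=
  (∃ P : SLP K m m, ComputesPowerToChebyshev P ∧ (P.cost : ℝ) ≤ B) ∧
  (∃ P : SLP K m m, ComputesChebyshevToPower P ∧ (P.cost : ℝ) ≤ B)

/-!
The change of basis is linear in each direction, and it is fast because it factors into a few
convolutions with fixed sequences.

Put `n = m - 1`. Since `Vᵢ (y + 1 / y) = y ^ i + 1 / y ^ i` for `i ≥ 1`, the polynomial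
`y ^ n * p (y + 1 / y)` is palindromic, and the coefficients of its upper half are those of `p` in
the modified Chebyshev basis (`joukowski_ofChebyshevCoeffs`). The identity
`1 / (y + 1 / y - 2) = (1 / (y - 1) + 1 / 2) ^ 2 - 1 / 4` writes the substitution `x = y + 1 / y` as
a composition of translations, inversions and one squaring. On coefficient vectors, inversions
and the squaring only rearrange, so `p` is converted by four Taylor shifts of polynomials of degree
at most `2 * n`, and undoing them one after the other gives the opposite conversion.

A Taylor shift is a convolution up to factorials (`coeff_taylor_eq_coeff_mul`), which are invertible
because the characteristic is zero or exceeds `2 * n`. A convolution with a fixed vector costs two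
Fourier transforms of a length `N = 2 ^ a * 3 ^ b > 4 * n` and `N` multiplications
(`Derives.mul_map`). Over a prime field, `N = 4 * m` is available because `4 * m` divides `q - 1`.
Over the reals, `N` is a power of two, the transforms take place over `ℂ`, and each complex
operation is simulated by at most six real ones (`Derives.real_of_complex`).

Costs are counted in a form that does not number intermediate results: `Derives K S N T` says that
`N` operations lead from a set `S` of elements of a `K`-algebra to a set `T`. In the algebra of
`K`-valued functions of the input, this is a straight-line program (`Derives.exists_slp`).
-/

/-! ### Derivations in a commutative algebra -/

/-- `Derives K S N T`: in the commutative `K`-algebra `R`, at most `N` arithmetic operations lead from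
the elements of `S` and the constants to all the elements of `T`. With `R` a ring of `K`-valued
functions, this is the existence of a straight-line program without reference to an enumeration of
the intermediate results. -/
inductive Derives (K : Type*) {R : Type*} [CommRing K] [CommRing R] [Algebra K R] :
    Set R → ℕ → Set R → Prop
  | done {S T : Set R} (N : ℕ) (h : T ⊆ S ∪ Set.range (algebraMap K R)) : Derives K S N T
  | step {S T : Set R} {N : ℕ} (op : ArithOp) {a b : R}
      (ha : a ∈ S ∪ Set.range (algebraMap K R)) (hb : b ∈ S ∪ Set.range (algebraMap K R))
      (h : Derives K (insert (op.eval a b) S) N T) : Derives K S (N + 1) T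

namespace Derives

variable {K R : Type*} [CommRing K] [CommRing R] [Algebra K R]
variable {S S' T T' U : Set R} {M N : ℕ}

theorem mono_left (h : Derives K S N T) (hS : S ⊆ S' ∪ Set.range (algebraMap K R)) :
    Derives K S' N T := by
  induction h generalizing S' with
  | done N h => exact done N (h.trans (Set.union_subset hS Set.subset_union_right))
  | step op ha hb _ ih =>
    have hS1 := Set.union_subset hS (Set.subset_union_right (s := S'))
    refine step op (hS1 ha) (hS1 hb) (ih ?_)
    rw [Set.insert_union]
    exact Set.insert_subset_insert hS

theorem mono_right (h : Derives K S N T) (hT : T' ⊆ T) : Derives K S N T' := by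
  induction h with
  | done N h => exact done N (hT.trans h)
  | step op ha hb _ ih => exact step op ha hb (ih hT)

theorem mono_cost (h : Derives K S N T) (hN : N ≤ M) : Derives K S M T := by
  induction h generalizing M with
  | done N h => exact done M h
  | step op ha hb _ ih =>
    obtain ⟨M, rfl⟩ : ∃ k, M = k + 1 := ⟨M - 1, by omega⟩
    exact step op ha hb (ih (by omega))

theorem of_subset (h : T ⊆ S) : Derives K S 0 T := done 0 (h.trans Set.subset_union_left)

/-- A second derivation may also use the inputs of the first. -/
theorem trans_union (h : Derives K S N T) (h' : Derives K (S ∪ T) M U) :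
    Derives K S (N + M) U := by
  induction h with
  | done N h =>
    exact (h'.mono_left (Set.union_subset Set.subset_union_left h)).mono_cost (by omega)
  | @step S T N op a b ha hb _ ih =>
    rw [Nat.add_right_comm]
    refine step op ha hb (ih (h'.mono_left ?_))
    exact (Set.union_subset_union_left _ (Set.subset_insert _ _)).trans Set.subset_union_left

theorem trans (h : Derives K S N T) (h' : Derives K T M U) : Derives K S (N + M) U :=
  h.trans_union (h'.mono_left (Set.subset_union_right.trans Set.subset_union_left))

theorem union_right (h : Derives K S N T) (W : Set R) : Derives K (S ∪ W) N (T ∪ W) := by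
  induction h with
  | done N h =>
    refine done N (Set.union_subset (h.trans ?_) ?_)
    · exact Set.union_subset_union_left _ Set.subset_union_left
    · exact Set.subset_union_right.trans Set.subset_union_left
  | @step S T N op a b ha hb _ ih =>
    have hS : S ∪ Set.range (algebraMap K R) ⊆ S ∪ W ∪ Set.range (algebraMap K R) :=
      Set.union_subset_union_left _ Set.subset_union_left
    exact step op (hS ha) (hS hb) (by rwa [Set.insert_union] at ih)

theorem union (h : Derives K S N T) (h' : Derives K S M U) : Derives K S (N + M) (T ∪ U) := by
  refine h.trans_union ((h'.union_right T).mono_right ?_)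
  rw [Set.union_comm]

theorem biUnion_lt {T : ℕ → Set R} {n c : ℕ} (h : ∀ i < n, Derives K S c (T i)) :
    Derives K S (n * c) (⋃ i < n, T i) := by
  induction n with
  | zero => exact done _ (by simp)
  | succ n ih =>
    rw [Nat.succ_mul, Set.biUnion_lt_succ]
    exact (ih fun i hi => h i (by omega)).union (h n (by omega))

theorem image_Iio {f : ℕ → R} {n c : ℕ} (h : ∀ i < n, Derives K S c {f i}) :
    Derives K S (n * c) (f '' Set.Iio n) :=
  (biUnion_lt h).mono_right (by rintro _ ⟨i, hi, rfl⟩; simpa using ⟨i, hi, rfl⟩)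

theorem smul_singleton {x : R} (hx : x ∈ S) (c : K) : Derives K S 1 {c • x} := by
  refine step .mul (a := algebraMap K R c) (b := x) (Or.inr ⟨c, rfl⟩) (Or.inl hx) (of_subset ?_)
  simp [ArithOp.eval, Algebra.smul_def]

theorem add_singleton {x y : R} (hx : x ∈ S) (hy : y ∈ S) : Derives K S 1 {x + y} :=
  step .add (Or.inl hx) (Or.inl hy) (of_subset (by simp [ArithOp.eval]))

/-- A linear combination of `r` elements takes `r` multiplications and `r` additions, counting the
addition to zero. -/
theorem sum_smul (c : ℕ → K) {x : ℕ → R} {r : ℕ} (hx : ∀ i < r, x i ∈ S) :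
    Derives K S (r * 2) {∑ i ∈ Finset.range r, c i • x i} := by
  induction r with
  | zero => exact done _ (by simpa using Or.inr ⟨0, map_zero _⟩)
  | succ r ih =>
    rw [Finset.sum_range_succ]
    have h := (ih fun i hi => hx i (by omega)).union (smul_singleton (hx r (by omega)) (c r))
    exact (h.trans (add_singleton (Or.inl rfl) (Or.inr rfl))).mono_cost (by omega)

/-- Over a ring of functions, a derivation is a straight-line program. -/
theorem exists_slp {X : Type*} {S T : Set (X → K)} {N k n : ℕ} (h : Derives K S N T)
    (v : Fin k → X → K) (hv : S ⊆ Set.range v) (g : Fin n → X → K) (hg : ∀ i, g i ∈ T) :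
    ∃ P : SLP K n k, P.cost ≤ N ∧ ∀ x, P.run (fun i => v i x) = fun i => g i x := by
  have operand {k : ℕ} {S : Set (X → K)} {v : Fin k → X → K} (hv : S ⊆ Set.range v)
      {a : X → K} (ha : a ∈ S ∪ Set.range (algebraMap K (X → K))) :
      ∃ o : Operand K k, ∀ x, o.eval (fun i => v i x) = a x := by
    rcases ha with ha | ⟨c, rfl⟩
    · obtain ⟨i, rfl⟩ := hv ha
      exact ⟨.val i, fun x => rfl⟩
    · exact ⟨.const c, fun x => rfl⟩
  induction h generalizing k with
  | done N h =>
    choose o ho using fun i => operand hv (h (hg i))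
    exact ⟨.output o, Nat.zero_le _, fun x => funext fun i => ho i x⟩
  | @step S T N op a b ha hb _ ih =>
    obtain ⟨oa, hoa⟩ := operand hv ha
    obtain ⟨ob, hob⟩ := operand hv hb
    obtain ⟨P, hP, hrun⟩ := ih (Fin.snoc (α := fun _ => X → K) v (op.eval a b)) (by
      rintro s (rfl | hs)
      · exact ⟨Fin.last k, Fin.snoc_last _ _⟩
      · obtain ⟨i, rfl⟩ := hv hs
        exact ⟨i.castSucc, Fin.snoc_castSucc _ _ _⟩) hg
    refine ⟨.step op oa ob P, Nat.succ_le_succ hP, fun x => ?_⟩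
    rw [← hrun x, SLP.run, hoa, hob]
    congr 1
    funext i
    refine Fin.lastCases ?_ (fun i => ?_) i
    · simp only [Fin.snoc_last]
      cases op <;> rfl
    · simp only [Fin.snoc_castSucc]

/-- The real and imaginary parts of a set of complex-valued functions. -/
def reIm {X : Type*} (S : Set (X → ℂ)) : Set (X → ℝ) :=
  (fun f x => (f x).re) '' S ∪ (fun f x => (f x).im) '' S

/-- A complex operation is at most six real ones on real and imaginary parts. -/
theorem real_of_complex {X : Type*} {S T : Set (X → ℂ)} {N : ℕ} (h : Derives ℂ S N T) :
    Derives ℝ (reIm S) (N * 6) (reIm T) := by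
  have parts {S : Set (X → ℂ)} {a : X → ℂ} (ha : a ∈ S ∪ Set.range (algebraMap ℂ (X → ℂ))) :
      (fun x => (a x).re) ∈ reIm S ∪ Set.range (algebraMap ℝ (X → ℝ)) ∧
        (fun x => (a x).im) ∈ reIm S ∪ Set.range (algebraMap ℝ (X → ℝ)) := by
    rcases ha with ha | ⟨c, rfl⟩
    · exact ⟨Or.inl (Or.inl ⟨a, ha, rfl⟩), Or.inl (Or.inr ⟨a, ha, rfl⟩)⟩
    · exact ⟨Or.inr ⟨c.re, rfl⟩, Or.inr ⟨c.im, rfl⟩⟩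
  induction h with
  | done N h =>
    refine done _ ?_
    rintro _ (⟨a, ha, rfl⟩ | ⟨a, ha, rfl⟩)
    exacts [(parts (h ha)).1, (parts (h ha)).2]
  | @step S T N op a b ha hb _ ih =>
    obtain ⟨har, hai⟩ := parts ha
    obtain ⟨hbr, hbi⟩ := parts hb
    have one (op : ArithOp) {S : Set (X → ℝ)} {a b : X → ℝ}
        (ha : a ∈ S ∪ Set.range (algebraMap ℝ (X → ℝ)))
        (hb : b ∈ S ∪ Set.range (algebraMap ℝ (X → ℝ))) : Derives ℝ S 1 {op.eval a b} :=
      step op ha hb (of_subset (by simp))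
    have key : Derives ℝ (reIm S) 6
        {(fun x => (op.eval a b x).re), (fun x => (op.eval a b x).im)} := by
      cases op with
      | add =>
        exact ((one .add har hbr).union (one .add hai hbi)).mono_cost (by omega)
      | sub =>
        exact ((one .sub har hbr).union (one .sub hai hbi)).mono_cost (by omega)
      | mul =>
        have h1 := ((one .mul har hbr).union (one .mul hai hbi)).trans
          (one .sub (Or.inl (Or.inl rfl)) (Or.inl (Or.inr rfl)))
        have h2 := ((one .mul har hbi).union (one .mul hai hbr)).trans
          (one .add (Or.inl (Or.inl rfl)) (Or.inl (Or.inr rfl)))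
        exact h1.union h2
    rw [Nat.succ_mul, Nat.add_comm]
    refine key.trans_union (ih.mono_left ?_)
    rintro _ (⟨f, rfl | hf, rfl⟩ | ⟨f, rfl | hf, rfl⟩)
    · exact Or.inl (Or.inr (Or.inl rfl))
    · exact Or.inl (Or.inl (Or.inl ⟨f, hf, rfl⟩))
    · exact Or.inl (Or.inr (Or.inr rfl))
    · exact Or.inl (Or.inl (Or.inr ⟨f, hf, rfl⟩))

end Derives

/-! ### Fast Fourier transform -/

section Fourier

variable {K R : Type*} [Field K] [CommRing R] [Algebra K R]

/-- The discrete Fourier transform with `N` terms; `ω` is meant to be an `N`-th root of unity. -/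
def dft (ω : K) (N : ℕ) (x : ℕ → R) (j : ℕ) : R :=
  ∑ k ∈ Finset.range N, ω ^ (j * k) • x k

theorem dft_mul_eq_sum_dft (ω : K) (r N : ℕ) (x : ℕ → R) (j : ℕ) :
    dft ω (r * N) x j =
      ∑ i ∈ Finset.range r, ω ^ (j * i) • dft (ω ^ r) N (fun k => x (r * k + i)) j := by
  have h (f : ℕ → R) : ∑ k ∈ Finset.range (r * N), f k =
      ∑ i ∈ Finset.range r, ∑ k ∈ Finset.range N, f (r * k + i) := by
    rw [Finset.sum_comm]
    induction N with
    | zero => simp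
    | succ N ih => rw [Nat.mul_succ, Finset.sum_range_add, ih, Finset.sum_range_succ]
  simp only [dft, h, Finset.smul_sum, smul_smul]
  refine Finset.sum_congr rfl fun i _ => Finset.sum_congr rfl fun k _ => ?_
  congr 1
  ring

theorem dft_mod {ω : K} {N : ℕ} (hω : ω ^ N = 1) (x : ℕ → R) (j : ℕ) :
    dft ω N x (j % N) = dft ω N x j := by
  refine Finset.sum_congr rfl fun k _ => ?_
  rw [pow_mul, pow_mul, ← pow_mod_orderOf ω (j % N), ← pow_mod_orderOf ω j,
    Nat.mod_mod_of_dvd _ (orderOf_dvd_of_pow_eq_one hω)]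

/-- One radix-`r` step of the fast Fourier transform. -/
theorem Derives.fft_mul {r N c : ℕ} {ω : K} (hr : 0 < r) (hN : 0 < N) (hω : ω ^ (r * N) = 1)
    (h : ∀ x : ℕ → R, Derives K (x '' Set.Iio N) c (Set.range (dft (ω ^ r) N x)))
    (x : ℕ → R) :
    Derives K (x '' Set.Iio (r * N)) (r * c + r * N * (r * 2)) (Set.range (dft ω (r * N) x)) := by
  have h1 : Derives K (x '' Set.Iio (r * N)) (r * c)
      (⋃ i < r, Set.range (dft (ω ^ r) N fun k => x (r * k + i))) := by
    refine Derives.biUnion_lt fun i hi => (h fun k => x (r * k + i)).mono_left ?_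
    rintro _ ⟨k, hk, rfl⟩
    refine Or.inl ⟨r * k + i, ?_, rfl⟩
    have : r * (k + 1) ≤ r * N := Nat.mul_le_mul_left r hk
    simp only [Set.mem_Iio]
    lia
  refine h1.trans ((Derives.image_Iio (f := dft ω (r * N) x) fun j _ => ?_).mono_right ?_)
  · rw [dft_mul_eq_sum_dft]
    exact Derives.sum_smul _ fun i hi => Set.mem_biUnion hi ⟨j, rfl⟩
  · rintro _ ⟨j, rfl⟩
    exact ⟨j % (r * N), Nat.mod_lt _ (Nat.mul_pos hr hN), dft_mod hω x j⟩

/-- The fast Fourier transform with radices two and three. -/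
theorem Derives.fft {a b : ℕ} {ω : K} (hω : ω ^ (2 ^ a * 3 ^ b) = 1) (x : ℕ → R) :
    Derives K (x '' Set.Iio (2 ^ a * 3 ^ b)) (6 * (2 ^ a * 3 ^ b) * (a + b))
      (Set.range (dft ω (2 ^ a * 3 ^ b) x)) := by
  induction a generalizing ω x with
  | zero =>
    induction b generalizing ω x with
    | zero =>
      refine (Derives.of_subset ?_).mono_cost (Nat.zero_le _)
      rintro _ ⟨j, rfl⟩
      exact ⟨0, by simp, by simp [dft]⟩
    | succ b ih =>
      have e : 2 ^ 0 * 3 ^ (b + 1) = 3 * (2 ^ 0 * 3 ^ b) := by ring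
      rw [e] at hω ⊢
      refine (Derives.fft_mul (by norm_num) (by positivity) hω (fun x => ih ?_ x) x).mono_cost ?_
      · rw [← pow_mul, hω]
      · exact le_of_eq (by ring)
  | succ a ih =>
    have e : 2 ^ (a + 1) * 3 ^ b = 2 * (2 ^ a * 3 ^ b) := by ring
    rw [e] at hω ⊢
    refine (Derives.fft_mul (by norm_num) (by positivity) hω (fun x => ih ?_ x) x).mono_cost ?_
    · rw [← pow_mul, hω]
    · generalize 2 ^ a * 3 ^ b = n
      nlinarith

open Polynomial

theorem dft_coeff {N : ℕ} (ω : K) {f : R[X]} (hf : f.natDegree < N) (j : ℕ) :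
    dft ω N f.coeff j = f.eval (algebraMap K R (ω ^ j)) := by
  rw [eval_eq_sum_range' hf, dft]
  refine Finset.sum_congr rfl fun k _ => ?_
  rw [Algebra.smul_def, pow_mul, map_pow, mul_comm]

theorem dft_inv_dft {N : ℕ} {ω : K} (hω : IsPrimitiveRoot ω N) (x : ℕ → R) {l : ℕ} (hl : l < N) :
    dft ω⁻¹ N (dft ω N x) l = (N : K) • x l := by
  have hω0 : ω ≠ 0 := hω.ne_zero (by omega)
  simp only [dft, Finset.smul_sum, smul_smul]
  rw [Finset.sum_comm]
  simp only [← Finset.sum_smul]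
  rw [Finset.sum_eq_single l]
  · congr 1
    rw [Finset.sum_congr rfl (g := fun _ => (1 : K)), Finset.sum_const, Finset.card_range,
      nsmul_one]
    intro j _
    rw [inv_pow, mul_comm l j, inv_mul_cancel₀ (pow_ne_zero _ hω0)]
  · intro k hk hkl
    rw [Finset.mem_range] at hk
    have hz : ω ^ k * (ω ^ l)⁻¹ ≠ 1 := fun h => hkl (hω.pow_inj hk hl (by
      rwa [mul_inv_eq_one₀ (pow_ne_zero _ hω0)] at h))
    have hs : ∑ j ∈ Finset.range N, (ω ^ k * (ω ^ l)⁻¹) ^ j = 0 := by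
      have h := geom_sum_mul (ω ^ k * (ω ^ l)⁻¹) N
      rw [mul_pow, inv_pow, ← pow_mul, ← pow_mul, mul_comm k, mul_comm l, pow_mul, pow_mul,
        hω.pow_eq_one, one_pow, one_pow, inv_one, mul_one, sub_self] at h
      exact (mul_eq_zero.1 h).resolve_right (sub_ne_zero.2 hz)
    rw [← zero_smul K (x k), ← hs]
    congr 1
    refine Finset.sum_congr rfl fun j _ => ?_
    rw [mul_pow, inv_pow, inv_pow, ← pow_mul, ← pow_mul, mul_comm k, mul_comm]
  · intro h
    exact absurd (Finset.mem_range.2 hl) h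

/-! ### Multiplication by a fixed polynomial and Taylor shifts -/

/-- It suffices to derive the coefficients up to the degree, as the others are the constant `0`. -/
theorem Derives.range_coeff {S : Set R} {f : R[X]} {d : ℕ} (hf : f.natDegree ≤ d)
    (h : ∀ i ≤ d, f.coeff i ∈ S) : Derives K S 0 (Set.range f.coeff) := by
  refine Derives.done 0 ?_
  rintro _ ⟨i, rfl⟩
  rcases le_or_gt i d with hi | hi
  · exact Or.inl (h i hi)
  · exact Or.inr ⟨0, by rw [map_zero, coeff_eq_zero_of_natDegree_lt (hf.trans_lt hi)]⟩

/-- Multiplication by a fixed polynomial: transform, multiply pointwise by constants, and transform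
back. -/
theorem Derives.mul_map {a b : ℕ} {ω : K} (hω : IsPrimitiveRoot ω (2 ^ a * 3 ^ b)) {f : R[X]}
    {g : K[X]} (hfg : f.natDegree + g.natDegree < 2 ^ a * 3 ^ b) :
    Derives K (Set.range f.coeff) (12 * (2 ^ a * 3 ^ b) * (a + b) + 2 ^ a * 3 ^ b)
      (Set.range (f * g.map (algebraMap K R)).coeff) := by
  have hfft1 := Derives.fft hω.pow_eq_one f.coeff
  have hfft2 := Derives.fft (R := R) hω.inv.pow_eq_one
  generalize hN : 2 ^ a * 3 ^ b = N at *
  have : NeZero N := ⟨by omega⟩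
  have hN0 : (N : K) ≠ 0 := hω.neZero'.out
  set h := f * g.map (algebraMap K R)
  have hh : h.natDegree < N :=
    (natDegree_mul_le.trans (Nat.add_le_add_left natDegree_map_le _)).trans_lt hfg
  -- The division by `N` is part of the multiplication by the transform of `g`.
  let z : ℕ → R := fun j => ((N : K)⁻¹ * g.eval (ω ^ j)) • dft ω N f.coeff j
  have hz : z = fun j => (N : K)⁻¹ • dft ω N h.coeff j := by
    funext j
    simp only [z, h]
    rw [dft_coeff ω hh, dft_coeff ω (show f.natDegree < N by omega), eval_mul, eval_map_algebraMap,
      aeval_algebraMap_apply, mul_smul, Algebra.smul_def (g.eval _), mul_comm (f.eval _)]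
    rfl
  have hinv (l : ℕ) (hl : l < N) : dft ω⁻¹ N z l = h.coeff l := by
    have h1 : dft ω⁻¹ N z l = (N : K)⁻¹ • dft ω⁻¹ N (dft ω N h.coeff) l := by
      rw [hz, dft, dft, Finset.smul_sum]
      exact Finset.sum_congr rfl fun k _ => smul_comm _ _ _
    rw [h1, dft_inv_dft hω _ hl, inv_smul_smul₀ hN0]
  have h1 : Derives K (Set.range f.coeff) (6 * N * (a + b)) (Set.range (dft ω N f.coeff)) :=
    hfft1.mono_left ((Set.image_subset_range _ _).trans Set.subset_union_left)
  have h2 : Derives K (Set.range (dft ω N f.coeff)) (N * 1) (z '' Set.Iio N) :=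
    Derives.image_Iio fun j _ => Derives.smul_singleton (Set.mem_range_self j) _
  have h3 : Derives K (Set.range (dft ω⁻¹ N z)) 0 (Set.range h.coeff) :=
    Derives.range_coeff (f := h) (d := N - 1) (by omega) fun l hl => ⟨l, hinv l (by omega)⟩
  exact (((h1.trans h2).trans (hfft2 z)).trans h3).mono_cost (le_of_eq (by ring))

/-- The coefficients of a Taylor shift are, up to factorials, a convolution. -/
theorem coeff_taylor_eq_coeff_mul {d : ℕ} (hd : (d.factorial : K) ≠ 0) (c : K) {f : R[X]}
    (hf : f.natDegree ≤ d) {k : ℕ} (hk : k ≤ d) :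
    (taylor (algebraMap K R c) f).coeff k = ((k.factorial : K)⁻¹) •
      ((∑ i ∈ Finset.range (d + 1), C (((d - i).factorial : K) • f.coeff (d - i)) * X ^ i) *
        (∑ i ∈ Finset.range (d + 1), C (c ^ i * (i.factorial : K)⁻¹) * X ^ i).map
          (algebraMap K R)).coeff (d - k) := by
  have hfac {i : ℕ} (hi : i ≤ d) : (i.factorial : K) ≠ 0 := fun h => hd (by
    obtain ⟨e, he⟩ := Nat.factorial_dvd_factorial hi
    rw [he, Nat.cast_mul, h, zero_mul])
  rw [taylor_coeff, eval_eq_sum_range' (n := d + 1 - k) (by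
    have := natDegree_hasseDeriv_le f k
    omega), coeff_mul, Finset.Nat.sum_antidiagonal_eq_sum_range_succ_mk, Finset.smul_sum,
    ← Finset.sum_range_reflect, show d + 1 - k = (d - k).succ by omega]
  refine Finset.sum_congr rfl fun i hi => ?_
  rw [Finset.mem_range] at hi
  have h1 : i < d + 1 := by omega
  have h2 : d - k - i < d + 1 := by omega
  have h3 : d - k + 1 - 1 - i = d - k - i := by omega
  have h4 : d - k - i + k = d - i := by omega
  simp only [hasseDeriv_coeff, coeff_map, finsetSum_coeff, coeff_C_mul_X_pow, h3, h4,
    Finset.sum_ite_eq, Finset.mem_range, h1, h2, if_true, Nat.succ_eq_add_one]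
  have hch : (((d - i).choose k : ℕ) : K) =
      (k.factorial : K)⁻¹ * ((d - i).factorial * ((d - k - i).factorial : K)⁻¹) := by
    have h := Nat.choose_mul_factorial_mul_factorial (show k ≤ d - i by omega)
    rw [show d - i - k = d - k - i by omega] at h
    have := hfac hk
    have := hfac (show d - k - i ≤ d by omega)
    field_simp
    rw [← h]
    push_cast
    ring
  have hch' : (((d - i).choose k : ℕ) : R) = algebraMap K R (((d - i).choose k : ℕ) : K) := by simp
  rw [hch', hch]
  simp only [Algebra.smul_def, map_mul, map_pow]
  ring

theorem natDegree_sum_C_mul_X_pow_le {A : Type*} [CommRing A] (d : ℕ) (u : ℕ → A) :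
    (∑ i ∈ Finset.range (d + 1), C (u i) * X ^ i).natDegree ≤ d :=
  natDegree_sum_le_of_forall_le _ _ fun i hi =>
    (natDegree_C_mul_X_pow_le _ _).trans (by rw [Finset.mem_range] at hi; omega)

theorem Derives.taylor_shift {a b : ℕ} {ω : K} (hω : IsPrimitiveRoot ω (2 ^ a * 3 ^ b)) {d : ℕ}
    (hd : (d.factorial : K) ≠ 0) (hN : 2 * d < 2 ^ a * 3 ^ b) (c : K) {f : R[X]}
    (hf : f.natDegree ≤ d) :
    Derives K (Set.range f.coeff) (12 * (2 ^ a * 3 ^ b) * (a + b) + 3 * (2 ^ a * 3 ^ b))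
      (Set.range (taylor (algebraMap K R c) f).coeff) := by
  let u : ℕ → R := fun i => ((d - i).factorial : K) • f.coeff (d - i)
  let F : R[X] := ∑ i ∈ Finset.range (d + 1), C (u i) * X ^ i
  let G : K[X] := ∑ i ∈ Finset.range (d + 1), C (c ^ i * (i.factorial : K)⁻¹) * X ^ i
  have hF : F.natDegree ≤ d := natDegree_sum_C_mul_X_pow_le _ _
  have hG : G.natDegree ≤ d := natDegree_sum_C_mul_X_pow_le _ _
  have h1 : Derives K (Set.range f.coeff) ((d + 1) * 1) (u '' Set.Iio (d + 1)) :=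
    Derives.image_Iio fun i _ => Derives.smul_singleton (Set.mem_range_self (d - i)) _
  have h2 : Derives K (u '' Set.Iio (d + 1)) 0 (Set.range F.coeff) :=
    Derives.range_coeff hF fun i hi => by
      refine ⟨i, by simp only [Set.mem_Iio]; omega, ?_⟩
      simp [F, Nat.lt_succ_of_le hi]
  have h3 := Derives.mul_map hω (f := F) (g := G) (by omega)
  have h4 : Derives K (Set.range (F * G.map (algebraMap K R)).coeff) ((d + 1) * 1)
      ((taylor (algebraMap K R c) f).coeff '' Set.Iio (d + 1)) :=
    Derives.image_Iio fun i hi => by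
      rw [coeff_taylor_eq_coeff_mul hd c hf (show i ≤ d by omega)]
      exact Derives.smul_singleton (Set.mem_range_self _) _
  have h5 : Derives K ((taylor (algebraMap K R c) f).coeff '' Set.Iio (d + 1)) 0
      (Set.range (taylor (algebraMap K R c) f).coeff) :=
    Derives.range_coeff ((natDegree_taylor _ _).trans_le hf) fun i hi =>
      ⟨i, Nat.lt_succ_of_le hi, rfl⟩
  refine ((((h1.trans h2).trans h3).trans h4).trans h5).mono_cost ?_
  generalize 12 * (2 ^ a * 3 ^ b) * (a + b) = t
  omega

end Fourier

/-! ### The substitution `x = y + 1 / y` -/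

section Substitution

open Polynomial

/-- For `p` of degree at most `n` and `h = 1 / 2`, this is the polynomial `y ^ n * p (y + 1 / y)`,
computed through the factorisation `1 / (y + 1 / y - 2) = (1 / (y - 1) + 1 / 2) ^ 2 - 1 / 4`. -/
noncomputable def joukowski {R : Type*} [CommRing R] (h : R) (n : ℕ) (p : R[X]) : R[X] :=
  taylor (-1) (reflect (2 * n) (taylor h (expand R 2
    (taylor (-h ^ 2) (reflect n (taylor 2 p))))))

/-- The left inverse of `joukowski`, inverting its factors one after the other. -/
noncomputable def invJoukowski {R : Type*} [CommRing R] (h : R) (n : ℕ) (P : R[X]) : R[X] :=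
  taylor (-2) (reflect n (taylor (h ^ 2) (contract 2
    (taylor (-h) (reflect (2 * n) (taylor 1 P))))))

section Ring

variable {R S : Type*} [CommRing R] [CommRing S]

theorem invJoukowski_joukowski (h : R) (n : ℕ) (p : R[X]) :
    invJoukowski h n (joukowski h n p) = p := by
  simp [invJoukowski, joukowski, taylor_taylor, contract_expand]

theorem map_joukowski (φ : R →+* S) (h : R) (n : ℕ) (p : R[X]) :
    (joukowski h n p).map φ = joukowski (φ h) n (p.map φ) := by
  simp [joukowski, map_taylor, ← reflect_map, map_expand, map_ofNat φ 2]

theorem map_invJoukowski (φ : R →+* S) (h : R) (n : ℕ) (P : R[X]) :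
    (invJoukowski h n P).map φ = invJoukowski (φ h) n (P.map φ) := by
  simp [invJoukowski, map_taylor, ← reflect_map, map_contract, map_ofNat φ 2]

theorem natDegree_reflect_le_of_le {n : ℕ} {p : R[X]} (hp : p.natDegree ≤ n) :
    (reflect n p).natDegree ≤ n :=
  natDegree_reflect_le.trans (max_le le_rfl hp)

theorem natDegree_contract_two_le {n : ℕ} {p : R[X]} (hp : p.natDegree ≤ 2 * n) :
    (contract 2 p).natDegree ≤ n := by
  refine natDegree_le_iff_coeff_eq_zero.2 fun i hi => ?_
  rw [coeff_contract two_ne_zero]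
  exact coeff_eq_zero_of_natDegree_lt (by omega)

/-- The polynomial of degree `2 * n` with the coefficients `c n, …, c 1, c 0, c 1, …, c n`. The
distance of `k` to `n` is written as a sum of two truncated differences, one of which vanishes. -/
noncomputable def palindrome {n : ℕ} (c : Fin (n + 1) → R) : R[X] :=
  ∑ k ∈ Finset.range (2 * n + 1), C (c (Fin.ofNat (n + 1) (k - n + (n - k)))) * X ^ k

theorem natDegree_palindrome_le {n : ℕ} (c : Fin (n + 1) → R) :
    (palindrome c).natDegree ≤ 2 * n :=
  natDegree_sum_C_mul_X_pow_le _ _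

theorem coeff_palindrome {n : ℕ} (c : Fin (n + 1) → R) {k : ℕ} (hk : k ≤ 2 * n) :
    (palindrome c).coeff k = c (Fin.ofNat (n + 1) (k - n + (n - k))) := by
  simp [palindrome, Nat.lt_succ_of_le hk]

theorem coeff_palindrome_add {n : ℕ} (c : Fin (n + 1) → R) (i : Fin (n + 1)) :
    (palindrome c).coeff (n + i) = c i := by
  rw [coeff_palindrome c (by omega)]
  congr 1
  ext
  simp only [Fin.val_ofNat]
  rw [show n + (i : ℕ) - n + (n - (n + i)) = i by omega, Nat.mod_eq_of_lt i.2]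

theorem map_palindrome (φ : R →+* S) {n : ℕ} (c : Fin (n + 1) → R) :
    (palindrome c).map φ = palindrome fun i => φ (c i) := by
  simp [palindrome, Polynomial.map_sum]

end Ring

section Field

variable {K : Type*} [Field K]

theorem eval_reflect {n : ℕ} {p : K[X]} (hp : p.natDegree ≤ n) {x : K} (hx : x ≠ 0) :
    (reflect n p).eval x = x ^ n * p.eval x⁻¹ := by
  let _ : Invertible x⁻¹ := ⟨x, mul_inv_cancel₀ hx, inv_mul_cancel₀ hx⟩
  have h := eval₂_reflect_mul_pow (RingHom.id K) x⁻¹ n p hp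
  have hinv : ⅟(x⁻¹) = x := rfl
  rw [hinv, eval₂_id, eval₂_id] at h
  rw [← h, mul_comm, mul_assoc, ← mul_pow, inv_mul_cancel₀ hx, one_pow, mul_one]

theorem eval_joukowski (h2 : (2 : K) ≠ 0) {n : ℕ} {p : K[X]} (hp : p.natDegree ≤ n) {y : K}
    (hy0 : y ≠ 0) (hy1 : y ≠ 1) :
    (joukowski 2⁻¹ n p).eval y = y ^ n * p.eval (y + y⁻¹) := by
  have hy : y + -1 ≠ 0 := fun h => hy1 (by linear_combination h)
  have hu : ((y + -1)⁻¹ + 2⁻¹) ^ 2 + -2⁻¹ ^ 2 = y / (y + -1) ^ 2 := by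
    field_simp
    ring
  have hu0 : y / (y + -1) ^ 2 ≠ 0 := div_ne_zero hy0 (pow_ne_zero _ hy)
  have h1 : (taylor 2 p).natDegree ≤ n := (natDegree_taylor _ _).trans_le hp
  rw [joukowski, taylor_eval, eval_reflect _ hy, taylor_eval, expand_eval, taylor_eval, hu,
    eval_reflect h1 hu0, taylor_eval, ← mul_assoc, pow_mul, ← mul_pow,
    mul_div_cancel₀ _ (pow_ne_zero 2 hy)]
  · congr 2
    field_simp
    ring
  · rw [natDegree_taylor, natDegree_expand, natDegree_taylor, mul_comm]
    exact Nat.mul_le_mul_left _ (natDegree_reflect_le_of_le h1)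

theorem modChebyshev_succ (h2 : (2 : K) ≠ 0) (i : ℕ) :
    modChebyshev K (i + 1) = dickson 1 (1 : K) (i + 1) := by
  let _ := invertibleOfNonzero h2
  rw [dickson_one_one_eq_chebyshev_T, modChebyshev, invOf_eq_inv]

theorem natDegree_modChebyshev (h2 : (2 : K) ≠ 0) (i : ℕ) : (modChebyshev K i).natDegree = i := by
  have : NeZero (2 : K) := ⟨h2⟩
  cases i with
  | zero => simp [modChebyshev]
  | succ i =>
    rw [modChebyshev, ← C_ofNat, natDegree_C_mul h2, natDegree_comp,
      natDegree_C_mul_X _ (inv_ne_zero h2), Chebyshev.natDegree_T, Int.natAbs_natCast, mul_one]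

theorem modChebyshev_ne_zero (h2 : (2 : K) ≠ 0) (i : ℕ) : modChebyshev K i ≠ 0 := by
  cases i with
  | zero => simp [modChebyshev]
  | succ i => exact ne_zero_of_natDegree_gt (n := i) (by rw [natDegree_modChebyshev h2]; omega)

theorem eval_map_modChebyshev {L : Type*} [Field L] (φ : K →+* L) (h2 : (2 : K) ≠ 0) {y : L}
    (hy : y ≠ 0) (i : ℕ) :
    ((modChebyshev K (i + 1)).map φ).eval (y + y⁻¹) = y ^ (i + 1) + y⁻¹ ^ (i + 1) := by
  rw [modChebyshev_succ h2, map_dickson, map_one,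
    dickson_one_one_eval_add_inv _ _ (mul_inv_cancel₀ hy)]

theorem natDegree_ofPowerCoeffs_le {n : ℕ} (p : Fin (n + 1) → K) :
    (ofPowerCoeffs p).natDegree ≤ n :=
  natDegree_sum_le_of_forall_le _ _ fun i _ => (natDegree_C_mul_X_pow_le _ _).trans (by omega)

theorem natDegree_ofChebyshevCoeffs_le (h2 : (2 : K) ≠ 0) {n : ℕ} (c : Fin (n + 1) → K) :
    (ofChebyshevCoeffs c).natDegree ≤ n :=
  natDegree_sum_le_of_forall_le _ _ fun i _ => (natDegree_C_mul_le _ _).trans (by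
    rw [natDegree_modChebyshev h2]
    omega)

theorem ofPowerCoeffs_coeff {n : ℕ} {p : K[X]} (hp : p.natDegree ≤ n) :
    ofPowerCoeffs (fun i : Fin (n + 1) => p.coeff i) = p := by
  rw [ofPowerCoeffs, ← Finset.sum_range fun i => C (p.coeff i) * X ^ i]
  exact Eq.symm (as_sum_range_C_mul_X_pow' _ (Nat.lt_succ_of_le hp))

theorem exists_ofChebyshevCoeffs_eq (h2 : (2 : K) ≠ 0) {n : ℕ} {p : K[X]} (hp : p.natDegree ≤ n) :
    ∃ c : Fin (n + 1) → K, ofChebyshevCoeffs c = p := by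
  let S : Polynomial.Sequence K :=
    ⟨modChebyshev K, fun i => by
      rw [degree_eq_natDegree (modChebyshev_ne_zero h2 i), natDegree_modChebyshev h2]⟩
  have hspan := S.span_degreeLT (m := n + 1) fun i _ =>
    (leadingCoeff_ne_zero.2 (modChebyshev_ne_zero h2 i)).isUnit
  have hmem : p ∈ Submodule.span K (S '' Set.Iio (n + 1)) := by
    rw [hspan, mem_degreeLT]
    exact degree_le_natDegree.trans_lt (by exact_mod_cast Nat.lt_succ_of_le hp)
  have himage : S '' Set.Iio (n + 1) = Set.range fun i : Fin (n + 1) => modChebyshev K i := by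
    ext f
    constructor
    · rintro ⟨i, hi, rfl⟩
      exact ⟨⟨i, hi⟩, rfl⟩
    · rintro ⟨i, rfl⟩
      exact ⟨i, i.2, rfl⟩
  rw [himage, Submodule.mem_span_range_iff_exists_fun] at hmem
  obtain ⟨c, rfl⟩ := hmem
  exact ⟨c, by simp [ofChebyshevCoeffs, smul_eq_C_mul]⟩

/-- As `Vᵢ (y + 1 / y) = y ^ i + 1 / y ^ i`, the substitution `x = y + 1 / y` exhibits the
coefficients in the modified Chebyshev basis. -/
theorem joukowski_ofChebyshevCoeffs (h2 : (2 : K) ≠ 0) {n : ℕ} (c : Fin (n + 1) → K) :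
    joukowski 2⁻¹ n (ofChebyshevCoeffs c) = palindrome c := by
  -- Both sides are compared at a transcendental element, since `K` may be finite.
  let φ : K →+* RatFunc K := algebraMap K (RatFunc K)
  let y : RatFunc K := RatFunc.X
  have hy0 : y ≠ 0 := RatFunc.X_ne_zero
  have hy1 : y ≠ 1 := by
    intro h
    rw [show y = algebraMap K[X] (RatFunc K) X from RatFunc.algebraMap_X.symm,
      ← map_one (algebraMap K[X] (RatFunc K)), ← C_1] at h
    exact X_ne_C 1 (RatFunc.algebraMap_injective K h)
  have hinj (f g : K[X]) (h : (f.map φ).eval y = (g.map φ).eval y) : f = g := by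
    have e (f : K[X]) : (f.map φ).eval y = algebraMap K[X] (RatFunc K) f := by
      rw [eval_map_algebraMap, show y = algebraMap K[X] (RatFunc K) X from
        RatFunc.algebraMap_X.symm, aeval_algebraMap_apply, aeval_X_left_apply]
    rw [e, e] at h
    exact RatFunc.algebraMap_injective K h
  have h2' : (2 : RatFunc K) ≠ 0 := by
    rw [← map_ofNat φ 2]
    exact (map_ne_zero φ).2 h2
  refine hinj _ _ ?_
  rw [map_joukowski, map_inv₀, map_ofNat, eval_joukowski h2'
    (natDegree_map_le.trans (natDegree_ofChebyshevCoeffs_le h2 c)) hy0 hy1]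
  let d : ℕ → RatFunc K := fun i => φ (c (Fin.ofNat (n + 1) i))
  have hl : ((ofChebyshevCoeffs c).map φ).eval (y + y⁻¹) =
      ∑ i ∈ Finset.range n, d (i + 1) * (y ^ (i + 1) + y⁻¹ ^ (i + 1)) + d 0 := by
    have hd : ((ofChebyshevCoeffs c).map φ).eval (y + y⁻¹) =
        ∑ i ∈ Finset.range (n + 1), d i * ((modChebyshev K i).map φ).eval (y + y⁻¹) := by
      rw [Finset.sum_range]
      simp [d, ofChebyshevCoeffs, Polynomial.map_sum, eval_finsetSum]
    rw [hd, Finset.sum_range_succ']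
    congr 1
    · exact Finset.sum_congr rfl fun i _ => by rw [eval_map_modChebyshev φ h2 hy0]
    · simp [modChebyshev]
  have hr : ((palindrome c).map φ).eval y =
      ∑ k ∈ Finset.range (2 * n + 1), d (k - n + (n - k)) * y ^ k := by
    simp [palindrome, d, Polynomial.map_sum, eval_finsetSum]
  rw [hl, hr, show 2 * n + 1 = n + (n + 1) by ring, Finset.sum_range_add, Finset.sum_range_succ',
    ← Finset.sum_range_reflect (fun k => d (k - n + (n - k)) * y ^ k) n, ← add_assoc,
    ← Finset.sum_add_distrib, mul_add, Finset.mul_sum]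
  congr 1
  · refine Finset.sum_congr rfl fun i hi => ?_
    rw [Finset.mem_range] at hi
    rw [show n - 1 - i - n + (n - (n - 1 - i)) = i + 1 by omega,
      show n + (i + 1) - n + (n - (n + (i + 1))) = i + 1 by omega]
    have h : y ^ n = y ^ (n - 1 - i) * y ^ (i + 1) := by
      rw [← pow_add]
      congr 1
      omega
    have h' : y ^ (i + 1) * y⁻¹ ^ (i + 1) = 1 := by
      rw [← mul_pow, mul_inv_cancel₀ hy0, one_pow]
    rw [pow_add y n, h]
    linear_combination d (i + 1) * y ^ (n - 1 - i) * h'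
  · simp [mul_comm]

end Field

end Substitution

/-! ### The cost of the change of basis -/

section Cost

open Polynomial

variable {K R : Type*} [Field K] [CommRing R] [Algebra K R]

theorem Derives.reflect {n : ℕ} {f : R[X]} (hf : f.natDegree ≤ n) :
    Derives K (Set.range f.coeff) 0 (Set.range (reflect n f).coeff) :=
  Derives.range_coeff (natDegree_reflect_le_of_le hf) fun i _ => by simp

theorem Derives.joukowski {a b : ℕ} {ω : K} (hω : IsPrimitiveRoot ω (2 ^ a * 3 ^ b)) {n : ℕ}
    (hn : ((2 * n).factorial : K) ≠ 0) (hN : 2 * (2 * n) < 2 ^ a * 3 ^ b) (h : K) {f : R[X]}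
    (hf : f.natDegree ≤ n) :
    Derives K (Set.range f.coeff) (4 * (12 * (2 ^ a * 3 ^ b) * (a + b) + 3 * (2 ^ a * 3 ^ b)))
      (Set.range (joukowski (algebraMap K R h) n f).coeff) := by
  have shift (c : K) {f : R[X]} (hf : f.natDegree ≤ 2 * n) := Derives.taylor_shift hω hn hN c hf
  have d1 : (taylor (algebraMap K R 2) f).natDegree ≤ n := (natDegree_taylor _ _).trans_le hf
  have d2 := natDegree_reflect_le_of_le d1
  have d3 := (natDegree_taylor _ (algebraMap K R (-h ^ 2))).trans_le d2
  have d4 := (natDegree_expand 2 _).trans_le ((Nat.mul_le_mul_right 2 d3).trans_eq (mul_comm n 2))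
  have d5 := (natDegree_taylor _ (algebraMap K R h)).trans_le d4
  have d6 := natDegree_reflect_le_of_le d5
  have hexp (g : R[X]) : Derives K (Set.range g.coeff) 0 (Set.range (expand R 2 g).coeff) := by
    refine Derives.done 0 ?_
    rintro _ ⟨i, rfl⟩
    rw [coeff_expand two_pos]
    split_ifs
    · exact Or.inl ⟨_, rfl⟩
    · exact Or.inr ⟨0, map_zero _⟩
  have key := ((((((shift 2 (by omega)).trans (Derives.reflect d1)).trans
    (shift (-h ^ 2) (by omega))).trans (hexp _)).trans (shift h d4)).trans
      (Derives.reflect d5)).trans (shift (-1) d6)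
  simp only [map_neg, map_pow, map_one, map_ofNat] at key
  exact key.mono_cost (by omega)

theorem Derives.invJoukowski {a b : ℕ} {ω : K} (hω : IsPrimitiveRoot ω (2 ^ a * 3 ^ b)) {n : ℕ}
    (hn : ((2 * n).factorial : K) ≠ 0) (hN : 2 * (2 * n) < 2 ^ a * 3 ^ b) (h : K) {f : R[X]}
    (hf : f.natDegree ≤ 2 * n) :
    Derives K (Set.range f.coeff) (4 * (12 * (2 ^ a * 3 ^ b) * (a + b) + 3 * (2 ^ a * 3 ^ b)))
      (Set.range (invJoukowski (algebraMap K R h) n f).coeff) := by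
  have shift (c : K) {f : R[X]} (hf : f.natDegree ≤ 2 * n) := Derives.taylor_shift hω hn hN c hf
  have d1 : (taylor (algebraMap K R 1) f).natDegree ≤ 2 * n := (natDegree_taylor _ _).trans_le hf
  have d2 := natDegree_reflect_le_of_le d1
  have d3 := (natDegree_taylor _ (algebraMap K R (-h))).trans_le d2
  have d4 := natDegree_contract_two_le d3
  have d5 := (natDegree_taylor _ (algebraMap K R (h ^ 2))).trans_le d4
  have d6 := natDegree_reflect_le_of_le d5
  have hcon (g : R[X]) : Derives K (Set.range g.coeff) 0 (Set.range (contract 2 g).coeff) := by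
    refine Derives.of_subset ?_
    rintro _ ⟨i, rfl⟩
    rw [coeff_contract two_ne_zero]
    exact ⟨_, rfl⟩
  have key := ((((((shift 1 hf).trans (Derives.reflect d1)).trans
    (shift (-h) d2)).trans (hcon _)).trans (shift (h ^ 2) (by omega))).trans
      (Derives.reflect d5)).trans (shift (-2) (by omega))
  simp only [map_neg, map_pow, map_one, map_ofNat] at key
  exact key.mono_cost (by omega)

/-- The conversion from the power basis, for a field `k` inside a field `K` with the roots of
unity. -/
theorem derives_chebyshev_of_power {k : Type*} [Field k] (φ : k →+* K) (h2 : (2 : k) ≠ 0)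
    {a b : ℕ} {ω : K} (hω : IsPrimitiveRoot ω (2 ^ a * 3 ^ b)) {n : ℕ}
    (hn : ((2 * n).factorial : K) ≠ 0) (hN : 2 * (2 * n) < 2 ^ a * 3 ^ b) :
    ∃ g : Fin (n + 1) → (Fin (n + 1) → k) → k,
      (∀ x, ofChebyshevCoeffs (fun i => g i x) = ofPowerCoeffs x) ∧
      Derives K (Set.range fun i (x : Fin (n + 1) → k) => φ (x i))
        (4 * (12 * (2 ^ a * 3 ^ b) * (a + b) + 3 * (2 ^ a * 3 ^ b)))
        (Set.range fun i x => φ (g i x)) := by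
  choose g hg using fun x : Fin (n + 1) → k =>
    exists_ofChebyshevCoeffs_eq h2 (natDegree_ofPowerCoeffs_le x)
  refine ⟨fun i x => g x i, hg, ?_⟩
  -- The input, as one polynomial over the ring of functions of the coefficients.
  let p : ((Fin (n + 1) → k) → K)[X] :=
    ∑ i : Fin (n + 1), C (fun x : Fin (n + 1) → k => φ (x i)) * X ^ (i : ℕ)
  have hp : p.natDegree ≤ n :=
    natDegree_sum_le_of_forall_le _ _ fun i _ => (natDegree_C_mul_X_pow_le _ _).trans (by omega)
  have hpx (x : Fin (n + 1) → k) : p.map (Pi.evalRingHom _ x) = (ofPowerCoeffs x).map φ := by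
    simp [p, ofPowerCoeffs, Polynomial.map_sum]
  have h1 : Derives K (Set.range fun i (x : Fin (n + 1) → k) => φ (x i)) 0
      (Set.range p.coeff) :=
    Derives.range_coeff hp fun i hi => ⟨⟨i, Nat.lt_succ_of_le hi⟩, by
      simp [p, coeff_X_pow,
        show ∀ j : Fin (n + 1), i = j ↔ (⟨i, Nat.lt_succ_of_le hi⟩ : Fin (n + 1)) = j from
          fun j => by rw [Fin.ext_iff]]⟩
  refine ((h1.trans (Derives.joukowski hω hn hN 2⁻¹ hp)).mono_right ?_).mono_cost (by omega)
  rintro _ ⟨i, rfl⟩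
  refine ⟨n + i, funext fun x => ?_⟩
  have h := congrArg (Polynomial.coeff · (n + i))
    (map_joukowski (Pi.evalRingHom (fun _ => K) x) (algebraMap K _ 2⁻¹) n p)
  have hc : Pi.evalRingHom (fun _ : Fin (n + 1) → k => K) x (algebraMap K _ 2⁻¹) = φ 2⁻¹ := by
    simp [map_ofNat φ 2]
  simp only [hc, hpx, ← map_joukowski, ← hg x, joukowski_ofChebyshevCoeffs h2, coeff_map,
    coeff_palindrome_add] at h
  exact h

/-- The conversion to the power basis, for a field `k` inside a field `K` with the roots of
unity. -/
theorem derives_power_of_chebyshev {k : Type*} [Field k] (φ : k →+* K) (h2 : (2 : k) ≠ 0)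
    {a b : ℕ} {ω : K} (hω : IsPrimitiveRoot ω (2 ^ a * 3 ^ b)) {n : ℕ}
    (hn : ((2 * n).factorial : K) ≠ 0) (hN : 2 * (2 * n) < 2 ^ a * 3 ^ b) :
    ∃ g : Fin (n + 1) → (Fin (n + 1) → k) → k,
      (∀ x, ofPowerCoeffs (fun i => g i x) = ofChebyshevCoeffs x) ∧
      Derives K (Set.range fun i (x : Fin (n + 1) → k) => φ (x i))
        (4 * (12 * (2 ^ a * 3 ^ b) * (a + b) + 3 * (2 ^ a * 3 ^ b)))
        (Set.range fun i x => φ (g i x)) := by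
  refine ⟨fun i x => (ofChebyshevCoeffs x).coeff i,
    fun x => ofPowerCoeffs_coeff (natDegree_ofChebyshevCoeffs_le h2 x), ?_⟩
  let P : ((Fin (n + 1) → k) → K)[X] := palindrome fun i x => φ (x i)
  have hPx (x : Fin (n + 1) → k) : P.map (Pi.evalRingHom _ x) = (palindrome x).map φ := by
    simp [P, map_palindrome]
  have h1 : Derives K (Set.range fun i (x : Fin (n + 1) → k) => φ (x i)) 0
      (Set.range P.coeff) :=
    Derives.range_coeff (natDegree_palindrome_le _) fun i hi =>
      ⟨_, (coeff_palindrome (fun i (x : Fin (n + 1) → k) => φ (x i)) hi).symm⟩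
  refine ((h1.trans (Derives.invJoukowski hω hn hN 2⁻¹
    (natDegree_palindrome_le _))).mono_right ?_).mono_cost (by omega)
  rintro _ ⟨i, rfl⟩
  refine ⟨i, funext fun x => ?_⟩
  have h := congrArg (Polynomial.coeff · (i : ℕ))
    (map_invJoukowski (Pi.evalRingHom (fun _ => K) x) (algebraMap K _ 2⁻¹) n P)
  have hc : Pi.evalRingHom (fun _ : Fin (n + 1) → k => K) x (algebraMap K _ 2⁻¹) = φ 2⁻¹ := by
    simp [map_ofNat φ 2]
  simp only [hc, hPx, ← map_invJoukowski, ← joukowski_ofChebyshevCoeffs h2,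
    invJoukowski_joukowski, coeff_map] at h
  exact h

theorem baseChangeWithin_of_derives {k : Type*} [Field k] {n B : ℕ}
    {g g' : Fin (n + 1) → (Fin (n + 1) → k) → k}
    (hg : ∀ x, ofChebyshevCoeffs (fun i => g i x) = ofPowerCoeffs x)
    (hg' : ∀ x, ofPowerCoeffs (fun i => g' i x) = ofChebyshevCoeffs x)
    (hB : Derives k (Set.range fun i (x : Fin (n + 1) → k) => x i) B (Set.range g))
    (hB' : Derives k (Set.range fun i (x : Fin (n + 1) → k) => x i) B (Set.range g')) :
    BaseChangeWithin k (n + 1) B := by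
  obtain ⟨P, hP, hrun⟩ := hB.exists_slp (fun i x => x i) subset_rfl g fun i => ⟨i, rfl⟩
  obtain ⟨P', hP', hrun'⟩ := hB'.exists_slp (fun i x => x i) subset_rfl g' fun i => ⟨i, rfl⟩
  exact ⟨⟨P, fun x => (congrArg ofChebyshevCoeffs (hrun x)).trans (hg x), by exact_mod_cast hP⟩,
    ⟨P', fun x => (congrArg ofPowerCoeffs (hrun' x)).trans (hg' x), by exact_mod_cast hP'⟩⟩

/-- The bound over a field that itself contains the roots of unity. -/
theorem baseChangeWithin_of_isPrimitiveRoot {a b : ℕ} {ω : K}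
    (hω : IsPrimitiveRoot ω (2 ^ a * 3 ^ b)) (h2 : (2 : K) ≠ 0) {n : ℕ}
    (hn : ((2 * n).factorial : K) ≠ 0) (hN : 2 * (2 * n) < 2 ^ a * 3 ^ b) :
    BaseChangeWithin K (n + 1)
      (4 * (12 * (2 ^ a * 3 ^ b) * (a + b) + 3 * (2 ^ a * 3 ^ b)) : ℕ) := by
  obtain ⟨g, hg, hB⟩ := derives_chebyshev_of_power (RingHom.id K) h2 hω hn hN
  obtain ⟨g', hg', hB'⟩ := derives_power_of_chebyshev (RingHom.id K) h2 hω hn hN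
  exact baseChangeWithin_of_derives hg hg' hB hB'

theorem baseChangeWithin_real {a b n : ℕ} (hN : 2 * (2 * n) < 2 ^ a * 3 ^ b) :
    BaseChangeWithin ℝ (n + 1)
      (4 * (12 * (2 ^ a * 3 ^ b) * (a + b) + 3 * (2 ^ a * 3 ^ b)) * 6 : ℕ) := by
  have hω := Complex.isPrimitiveRoot_exp (2 ^ a * 3 ^ b) (by positivity)
  have hn : ((2 * n).factorial : ℂ) ≠ 0 := by exact_mod_cast Nat.factorial_ne_zero _
  have real {B : ℕ} {g : Fin (n + 1) → (Fin (n + 1) → ℝ) → ℝ}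
      (h : Derives ℂ (Set.range fun i (x : Fin (n + 1) → ℝ) => Complex.ofRealHom (x i)) B
        (Set.range fun i x => Complex.ofRealHom (g i x))) :
      Derives ℝ (Set.range fun i (x : Fin (n + 1) → ℝ) => x i) (B * 6) (Set.range g) := by
    refine (h.real_of_complex.mono_right ?_).mono_left ?_
    · rintro _ ⟨i, rfl⟩
      exact Or.inl ⟨_, ⟨i, rfl⟩, rfl⟩
    · rintro _ (⟨_, ⟨i, rfl⟩, rfl⟩ | ⟨_, ⟨i, rfl⟩, rfl⟩)
      · exact Or.inl ⟨i, rfl⟩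
      · exact Or.inr ⟨0, rfl⟩
  obtain ⟨g, hg, hB⟩ := derives_chebyshev_of_power Complex.ofRealHom two_ne_zero hω hn hN
  obtain ⟨g', hg', hB'⟩ := derives_power_of_chebyshev Complex.ofRealHom two_ne_zero hω hn hN
  exact baseChangeWithin_of_derives hg hg' (real hB) (real hB')

theorem BaseChangeWithin.mono {m : ℕ} {B B' : ℝ} (h : BaseChangeWithin K m B) (hB : B ≤ B') :
    BaseChangeWithin K m B' := by
  obtain ⟨⟨P, hP, hc⟩, P', hP', hc'⟩ := h
  exact ⟨⟨P, hP, hc.trans hB⟩, P', hP', hc'.trans hB⟩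

theorem baseChangeWithin_one : BaseChangeWithin K 1 0 := by
  have h (x : Fin 1 → K) : ofChebyshevCoeffs x = ofPowerCoeffs x := by
    simp [ofChebyshevCoeffs, ofPowerCoeffs, modChebyshev]
  refine ⟨⟨.output fun i => .val i, fun x => h x, by simp [SLP.cost]⟩,
    ⟨.output fun i => .val i, fun x => (h x).symm, by simp [SLP.cost]⟩⟩

/-- The cost of four Taylor shifts, and of their simulation by real arithmetic, is `O(m log m)` when
the transform length is at most `8 * m`; `m = 1` is excluded because `log 1 = 0`. -/
theorem cost_le {m N l : ℕ} (hm : 2 ≤ m) (hN : N ≤ 8 * m) (hl : l ≤ Nat.log 2 m + 3) :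
    ((4 * (12 * N * l + 3 * N) * 6 : ℕ) : ℝ) ≤ 20000 * (m * Real.log m) := by
  have h1 : 1 ≤ Nat.log 2 m := Nat.log_pos (by norm_num) hm
  have h2 : 4 * (12 * N * l + 3 * N) * 6 ≤ 9792 * (m * Nat.log 2 m) := by
    calc 4 * (12 * N * l + 3 * N) * 6 = 72 * (N * (4 * l + 1)) := by ring
      _ ≤ 72 * (8 * m * (17 * Nat.log 2 m)) :=
        Nat.mul_le_mul_left _ (Nat.mul_le_mul hN (by omega))
      _ = 9792 * (m * Nat.log 2 m) := by ring
  have h3 : (Nat.log 2 m : ℝ) ≤ 2 * Real.log m := by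
    have h : Real.log ((2 : ℝ) ^ Nat.log 2 m) ≤ Real.log m :=
      Real.log_le_log (by positivity) (by exact_mod_cast Nat.pow_log_le_self 2 (by omega))
    rw [Real.log_pow] at h
    have := Real.log_two_gt_d9
    have : (0 : ℝ) ≤ Nat.log 2 m := Nat.cast_nonneg _
    nlinarith
  calc ((4 * (12 * N * l + 3 * N) * 6 : ℕ) : ℝ) ≤ ((9792 * (m * Nat.log 2 m) : ℕ) : ℝ) := by
        exact_mod_cast h2
    _ = 9792 * (m * (Nat.log 2 m : ℝ)) := by push_cast; ring
    _ ≤ 9792 * (m * (2 * Real.log m)) := by gcongr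
    _ ≤ 20000 * (m * Real.log m) := by
      have : 0 ≤ m * Real.log m := mul_nonneg m.cast_nonneg (Real.log_natCast_nonneg m)
      linarith

theorem ZMod.exists_isPrimitiveRoot {q N : ℕ} [Fact q.Prime] (h : N ∣ q - 1) :
    ∃ ω : ZMod q, IsPrimitiveRoot ω N := by
  obtain ⟨g, hg⟩ := IsCyclic.exists_ofOrder_eq_natCard (α := (ZMod q)ˣ)
  rw [Nat.card_eq_fintype_card, ZMod.card_units] at hg
  obtain ⟨e, he⟩ := h
  have hroot : IsPrimitiveRoot (g : ZMod q) (q - 1) := by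
    rw [IsPrimitiveRoot.coe_units_iff, ← hg]
    exact IsPrimitiveRoot.orderOf g
  exact ⟨_, hroot.pow (Nat.sub_pos_of_lt (Fact.out : q.Prime).one_lt) (he.trans (mul_comm N e))⟩

end Cost

theorem mainTheorem3 :
    ∃ A : ℝ,
      (∀ m : ℕ, 1 ≤ m → BaseChangeWithin ℝ m (A * (m * Real.log m))) ∧
      (∀ (m a b : ℕ), m = 2 ^ a * 3 ^ b →
        ∀ (q : ℕ) [Fact q.Prime], q ≡ 1 [MOD 4 * m] →
          BaseChangeWithin (ZMod q) m (A * (m * Real.log m))) := by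
  refine ⟨20000, fun m hm => ?_, fun m a b hm q _ hq => ?_⟩
  · obtain rfl | hm2 : m = 1 ∨ 2 ≤ m := by omega
    · simpa using baseChangeWithin_one (K := ℝ)
    obtain ⟨n, rfl⟩ : ∃ n, m = n + 1 := ⟨m - 1, by omega⟩
    -- The transform length is the power of two in `(4 * m, 8 * m]`.
    have h1 := Nat.lt_pow_succ_log_self (b := 2) (by norm_num) (n + 1)
    have h2 := Nat.pow_log_le_self 2 (x := n + 1) (by omega)
    have hp : 2 ^ (Nat.log 2 (n + 1) + 3) * 3 ^ 0 = 4 * 2 ^ (Nat.log 2 (n + 1)).succ := by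
      rw [Nat.succ_eq_add_one]
      ring
    have hp' : 2 ^ (Nat.log 2 (n + 1) + 3) * 3 ^ 0 = 8 * 2 ^ Nat.log 2 (n + 1) := by ring
    refine (baseChangeWithin_real (a := Nat.log 2 (n + 1) + 3) (b := 0) (n := n)
      (by omega)).mono (cost_le hm2 ?_ (by omega))
    omega
  · have hq1 : 1 < q := (Fact.out : q.Prime).one_lt
    have hdvd : 4 * m ∣ q - 1 := (Nat.modEq_iff_dvd' hq1.le).1 hq.symm
    have hmpos : 0 < m := by rw [hm]; positivity
    have hqm : 4 * m ≤ q - 1 := Nat.le_of_dvd (by omega) hdvd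
    obtain rfl | hm2 : m = 1 ∨ 2 ≤ m := by omega
    · simpa using baseChangeWithin_one (K := ZMod q)
    obtain ⟨n, rfl⟩ : ∃ n, m = n + 1 := ⟨m - 1, by omega⟩
    have hN : 4 * (n + 1) = 2 ^ (a + 2) * 3 ^ b := by rw [hm]; ring
    obtain ⟨ω, hω⟩ := ZMod.exists_isPrimitiveRoot hdvd
    rw [hN] at hω
    have hfac : (((2 * n).factorial : ℕ) : ZMod q) ≠ 0 := by
      rw [Ne, ZMod.natCast_eq_zero_iff, (Fact.out : q.Prime).dvd_factorial]
      omega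
    have h2 : (2 : ZMod q) ≠ 0 := by
      have : ((2 : ℕ) : ZMod q) ≠ 0 := by
        rw [Ne, ZMod.natCast_eq_zero_iff]
        exact fun h => by have := Nat.le_of_dvd two_pos h; omega
      exact_mod_cast this
    have hab : a + b ≤ Nat.log 2 (n + 1) := by
      refine Nat.le_log_of_pow_le (by norm_num) ?_
      rw [pow_add, hm]
      exact Nat.mul_le_mul_left _ (Nat.pow_le_pow_left (by norm_num) _)
    refine (baseChangeWithin_of_isPrimitiveRoot hω h2 hfac (by omega)).mono
      (le_trans ?_ (cost_le (N := 2 ^ (a + 2) * 3 ^ b) (l := a + 2 + b) hm2 (by omega) (by omega)))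
    exact_mod_cast Nat.le_mul_of_pos_right _ (by norm_num)
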